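/- Let $N\ge 2$, let $\Omega\subseteq\mathbb R^N$ be a bounded domain (nonempty, open, connected) with Lipschitz boundary, let $p,q\in C(\overline\Omega)$ satisfy $1<p(x)<N$ and $p(x)<q(x)$ for all $x\in\overline\Omega$, and let $0\le\mu\in L^1(\Omega)$. Put $\mathcal H(x,t)=t^{p(x)}+\mu(x)t^{q(x)}$ for $x\in\Omega$, $t\ge 0$, let $L^{\mathcal H}(\Omega)$ be the space of (classes of) measurable $u\colon\Omega\to\mathbb R$ with $\int_\Omega\mathcal H(x,|u|)\,dx<\infty$, and let $W^{1,\mathcal H}(\Omega)$ be the space of all $u\in L^{\mathcal H}(\Omega)$ that have a weak gradient $\nabla u$ on $\Omega$ with $|\nabla u|\in L^{\mathcal H}(\Omega)$. For $u\in W^{1,\mathcal H}(\Omega)$ set $$\hat\rho_{\mathcal H}(u)=\int_\Omega\left(|\nabla u|^{p(x)}+\mu(x)|\nabla u|^{q(x)}\right)dx+\int_\Omega\left(|u|^{p(x)}+\mu(x)|u|^{q(x)}\right)dx,\qquad \|u\|_{\hat\rho_{\mathcal H}}=\inf\{\lambda>0:\hat\rho_{\mathcal H}(u/\lambda)\le 1\},$$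 and equip $W^{1,\mathcal H}(\Omega)$ with the norm $\|\cdot\|_{\hat\rho_{\mathcal H}}$. Then: (i) The norm $\|\cdot\|_{\hat\rho_{\mathcal H}}$ on $W^{1,\mathcal H}(\Omega)$ is uniformly convex: for every $\varepsilon>0$ there is $\delta>0$ such that $\|u+v\|_{\hat\rho_{\mathcal H}}\le 2-\delta$ whenever $\|u\|_{\hat\rho_{\mathcal H}}=\|v\|_{\hat\rho_{\mathcal H}}=1$ and $\|u-v\|_{\hat\rho_{\mathcal H}}\ge\varepsilon$. (ii) If $(u_n)_{n\in\mathbb N}\subseteq W^{1,\mathcal H}(\Omega)$ and $u\in W^{1,\mathcal H}(\Omega)$ satisfy $u_n\rightharpoonup u$ weakly in $W^{1,\mathcal H}(\Omega)$ and $\hat\rho_{\mathcal H}(u_n)\to\hat\rho_{\mathcal H}(u)$, then $u_n\to u$ in $W^{1,\mathcal H}(\Omega)$. -/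

import Mathlib

open MeasureTheory Filter Topology Set
open scoped ENNReal ContDiff

noncomputable section

namespace DoublePhase

/-- `Ω` has Lipschitz boundary: near each boundary point, in suitable orthogonal coordinates
(`ν` is the vertical direction), `Ω` is the strict epigraph of a Lipschitz function defined on
the hyperplane orthogonal to `ν`. -/
def HasLipschitzBoundary {N : ℕ} (Ω : Set (EuclideanSpace ℝ (Fin N))) : Prop :=
  ∀ x₀ ∈ frontier Ω, ∃ (r : ℝ) (ν : EuclideanSpace ℝ (Fin N)) (K : NNReal)
    (γ : (Submodule.span ℝ {ν})ᗮ → ℝ), 0 < r ∧ ‖ν‖ = 1 ∧ LipschitzWith K γ ∧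
      ∀ x ∈ Metric.ball x₀ r,
        (x ∈ Ω ↔ γ ((Submodule.span ℝ {ν})ᗮ.orthogonalProjectionOnto x) < inner ℝ ν x)

/-- The standing hypotheses: `Ω ⊆ ℝᴺ`, `N ≥ 2`, is a bounded domain (nonempty, open, connected)
with Lipschitz boundary; `p` and `q` are continuous on the closure of `Ω`, with
`1 < p(x) < N` and `p(x) < q(x)` there; and `0 ≤ μ ∈ L¹(Ω)`. -/
structure Hypotheses {N : ℕ} (Ω : Set (EuclideanSpace ℝ (Fin N)))
    (p q μ : EuclideanSpace ℝ (Fin N) → ℝ) : Prop where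
  two_le_dim : 2 ≤ N
  isOpen : IsOpen Ω
  isConnected : IsConnected Ω
  isBounded : Bornology.IsBounded Ω
  lipschitzBoundary : HasLipschitzBoundary Ω
  continuousOn_p : ContinuousOn p (closure Ω)
  continuousOn_q : ContinuousOn q (closure Ω)
  one_lt_p : ∀ x ∈ closure Ω, 1 < p x
  p_lt_dim : ∀ x ∈ closure Ω, p x < N
  p_lt_q : ∀ x ∈ closure Ω, p x < q x
  weight_nonneg : ∀ᵐ x ∂(volume.restrict Ω), 0 ≤ μ x
  weight_integrable : IntegrableOn μ Ω

/-- The double phase function `H(x, t) = t ^ p(x) + μ(x) t ^ q(x)`. -/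
def H {N : ℕ} (p q μ : EuclideanSpace ℝ (Fin N) → ℝ) (x : EuclideanSpace ℝ (Fin N)) (t : ℝ) : ℝ :=
  t ^ p x + μ x * t ^ q x

/-- The modular `ρ_H(v) = ∫_Ω H(x, |v(x)|) dx`, with values in `[0, ∞]`, for (classes of)
measurable functions `v` on `Ω` that are real valued or vector valued. -/
def modular {N : ℕ} (Ω : Set (EuclideanSpace ℝ (Fin N))) (p q μ : EuclideanSpace ℝ (Fin N) → ℝ)
    {F : Type*} [NormedAddCommGroup F]
    (v : EuclideanSpace ℝ (Fin N) →ₘ[volume.restrict Ω] F) : ℝ≥0∞ :=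
  ∫⁻ x in Ω, ENNReal.ofReal (H p q μ x ‖v x‖)

/-- `g` is the weak gradient of `u` on `Ω`: both are locally integrable on `Ω` and
`∫_Ω u ∂ᵢφ = -∫_Ω gᵢ φ` for every test function `φ ∈ C_c^∞(Ω)` and every `i`. -/
def IsWeakGradient {N : ℕ} (Ω : Set (EuclideanSpace ℝ (Fin N)))
    (u : EuclideanSpace ℝ (Fin N) →ₘ[volume.restrict Ω] ℝ)
    (g : EuclideanSpace ℝ (Fin N) →ₘ[volume.restrict Ω] EuclideanSpace ℝ (Fin N)) : Prop :=
  LocallyIntegrableOn u Ω ∧ LocallyIntegrableOn g Ω ∧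
    ∀ φ : EuclideanSpace ℝ (Fin N) → ℝ, ContDiff ℝ ∞ φ → HasCompactSupport φ → tsupport φ ⊆ Ω →
      ∀ i : Fin N, ∫ x in Ω, u x * fderiv ℝ φ x (EuclideanSpace.single i 1)
        = -∫ x in Ω, g x i * φ x

open Classical in
/-- The weak gradient of `u` on `Ω` (it is unique, see `IsWeakGradient.unique`); `0` if there is
none. -/
def weakGradient {N : ℕ} (Ω : Set (EuclideanSpace ℝ (Fin N)))
    (u : EuclideanSpace ℝ (Fin N) →ₘ[volume.restrict Ω] ℝ) :
    EuclideanSpace ℝ (Fin N) →ₘ[volume.restrict Ω] EuclideanSpace ℝ (Fin N) :=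
  if h : ∃ g, IsWeakGradient Ω u g then h.choose else 0

section WeakGradient

variable {N : ℕ} {Ω : Set (EuclideanSpace ℝ (Fin N))}

theorem locallyIntegrableOn_congr {F : Type*} [NormedAddCommGroup F] (hΩ : IsOpen Ω)
    {f g : EuclideanSpace ℝ (Fin N) → F} (hf : LocallyIntegrableOn f Ω)
    (h : f =ᵐ[volume.restrict Ω] g) : LocallyIntegrableOn g Ω := by
  rw [locallyIntegrableOn_iff hΩ.isLocallyClosed] at hf ⊢
  intro k hk hkc
  exact (hf k hk hkc).congr_fun_ae (ae_restrict_of_ae_restrict_of_subset hk h)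

theorem integrable_mul_test {f ψ : EuclideanSpace ℝ (Fin N) → ℝ}
    (hf : LocallyIntegrableOn f Ω) (hψ : Continuous ψ) (hc : HasCompactSupport ψ)
    (hs : tsupport ψ ⊆ Ω) : IntegrableOn (fun x => f x * ψ x) Ω := by
  have h1 := (hf.integrableOn_compact_subset hs hc).mul_continuousOn hψ.continuousOn hc
  refine Integrable.integrableOn ?_
  refine (integrableOn_iff_integrable_of_support_subset ?_).1 h1
  intro x hx
  apply subset_tsupport
  intro h0
  exact hx (by simp [h0])

theorem locallyIntegrableOn_coord {g : EuclideanSpace ℝ (Fin N) → EuclideanSpace ℝ (Fin N)}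
    (hΩ : IsOpen Ω) (hg : LocallyIntegrableOn g Ω) (i : Fin N) :
    LocallyIntegrableOn (fun x => g x i) Ω := by
  rw [locallyIntegrableOn_iff hΩ.isLocallyClosed] at hg ⊢
  intro k hk hkc
  exact (EuclideanSpace.proj (𝕜 := ℝ) i).integrable_comp (hg k hk hkc)

theorem IsWeakGradient.unique (hΩ : IsOpen Ω)
    {u : EuclideanSpace ℝ (Fin N) →ₘ[volume.restrict Ω] ℝ}
    {g g' : EuclideanSpace ℝ (Fin N) →ₘ[volume.restrict Ω] EuclideanSpace ℝ (Fin N)}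
    (h : IsWeakGradient Ω u g) (h' : IsWeakGradient Ω u g') : g = g' := by
  have key : ∀ i : Fin N, ∀ᵐ x ∂(volume : Measure (EuclideanSpace ℝ (Fin N))),
      x ∈ Ω → g x i - g' x i = 0 := by
    intro i
    have hgi := locallyIntegrableOn_coord hΩ h.2.1 i
    have hgi' := locallyIntegrableOn_coord hΩ h'.2.1 i
    refine hΩ.ae_eq_zero_of_integral_contDiff_smul_eq_zero (hgi.sub hgi') ?_
    intro φ hφ hc hs
    have e1 := h.2.2 φ hφ hc hs i
    have e2 := h'.2.2 φ hφ hc hs i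
    have i1 := integrable_mul_test hgi hφ.continuous hc hs
    have i2 := integrable_mul_test hgi' hφ.continuous hc hs
    have e3 := integral_sub i1 i2
    have e4 : ∫ x in Ω, φ x • ((fun x => g x i) - (fun x => g' x i)) x
        = ∫ x, φ x • ((fun x => g x i) - (fun x => g' x i)) x := by
      refine setIntegral_eq_integral_of_forall_compl_eq_zero ?_
      intro x hx
      have : φ x = 0 := image_eq_zero_of_notMem_tsupport (fun hx' => hx (hs hx'))
      simp [this]
    refine e4.symm.trans ?_
    have e5 : ∫ x in Ω, φ x • ((fun x => g x i) - (fun x => g' x i)) x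
        = ∫ x in Ω, (g x i * φ x - g' x i * φ x) := by
      congr 1
      ext x
      simp only [Pi.sub_apply, smul_eq_mul]
      ring
    rw [e5, e3]
    linarith
  apply AEEqFun.ext
  rw [EventuallyEq, ae_restrict_iff' hΩ.measurableSet]
  filter_upwards [ae_all_iff.2 key] with x hx hxΩ
  ext i
  linarith [hx i hxΩ]

theorem IsWeakGradient.add (hΩ : IsOpen Ω)
    {u v : EuclideanSpace ℝ (Fin N) →ₘ[volume.restrict Ω] ℝ}
    {g k : EuclideanSpace ℝ (Fin N) →ₘ[volume.restrict Ω] EuclideanSpace ℝ (Fin N)}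
    (h : IsWeakGradient Ω u g) (h' : IsWeakGradient Ω v k) :
    IsWeakGradient Ω (u + v) (g + k) := by
  refine ⟨locallyIntegrableOn_congr hΩ (h.1.add h'.1) (AEEqFun.coeFn_add u v).symm,
    locallyIntegrableOn_congr hΩ (h.2.1.add h'.2.1) (AEEqFun.coeFn_add g k).symm, ?_⟩
  intro φ hφ hc hs i
  have hd : Continuous fun x => fderiv ℝ φ x (EuclideanSpace.single i 1) :=
    (hφ.continuous_fderiv (by simp)).clm_apply continuous_const
  have hdc : HasCompactSupport fun x => fderiv ℝ φ x (EuclideanSpace.single i 1) :=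
    hc.fderiv_apply (𝕜 := ℝ) _
  have hds : tsupport (fun x => fderiv ℝ φ x (EuclideanSpace.single i 1)) ⊆ Ω :=
    (tsupport_fderiv_apply_subset ℝ _).trans hs
  have e1 := integral_add (integrable_mul_test h.1 hd hdc hds)
    (integrable_mul_test h'.1 hd hdc hds)
  have e2 := integral_add
    (integrable_mul_test (locallyIntegrableOn_coord hΩ h.2.1 i) hφ.continuous hc hs)
    (integrable_mul_test (locallyIntegrableOn_coord hΩ h'.2.1 i) hφ.continuous hc hs)
  have e3 : ∫ x in Ω, (u + v) x * fderiv ℝ φ x (EuclideanSpace.single i 1)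
      = ∫ x in Ω, (u x * fderiv ℝ φ x (EuclideanSpace.single i 1)
        + v x * fderiv ℝ φ x (EuclideanSpace.single i 1)) := by
    refine integral_congr_ae ?_
    filter_upwards [AEEqFun.coeFn_add u v] with x hx
    simp [hx, add_mul]
  have e4 : ∫ x in Ω, (g + k) x i * φ x = ∫ x in Ω, (g x i * φ x + k x i * φ x) := by
    refine integral_congr_ae ?_
    filter_upwards [AEEqFun.coeFn_add g k] with x hx
    simp [hx, add_mul]
  rw [e3, e4, e1, e2, h.2.2 φ hφ hc hs i, h'.2.2 φ hφ hc hs i]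
  ring

theorem IsWeakGradient.smul (hΩ : IsOpen Ω) (c : ℝ)
    {u : EuclideanSpace ℝ (Fin N) →ₘ[volume.restrict Ω] ℝ}
    {g : EuclideanSpace ℝ (Fin N) →ₘ[volume.restrict Ω] EuclideanSpace ℝ (Fin N)}
    (h : IsWeakGradient Ω u g) : IsWeakGradient Ω (c • u) (c • g) := by
  refine ⟨locallyIntegrableOn_congr hΩ (h.1.smul c) (AEEqFun.coeFn_smul c u).symm,
    locallyIntegrableOn_congr hΩ (h.2.1.smul c) (AEEqFun.coeFn_smul c g).symm, ?_⟩
  intro φ hφ hc hs i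
  have e3 : ∫ x in Ω, (c • u) x * fderiv ℝ φ x (EuclideanSpace.single i 1)
      = ∫ x in Ω, c * (u x * fderiv ℝ φ x (EuclideanSpace.single i 1)) := by
    refine integral_congr_ae ?_
    filter_upwards [AEEqFun.coeFn_smul c u] with x hx
    simp [hx, mul_assoc]
  have e4 : ∫ x in Ω, (c • g) x i * φ x = ∫ x in Ω, c * (g x i * φ x) := by
    refine integral_congr_ae ?_
    filter_upwards [AEEqFun.coeFn_smul c g] with x hx
    simp [hx, mul_assoc]
  rw [e3, e4, integral_const_mul, integral_const_mul, h.2.2 φ hφ hc hs i]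
  ring

theorem isWeakGradient_zero (hΩ : IsOpen Ω) :
    IsWeakGradient Ω (0 : EuclideanSpace ℝ (Fin N) →ₘ[volume.restrict Ω] ℝ) 0 := by
  refine ⟨locallyIntegrableOn_congr hΩ (locallyIntegrableOn_zero) AEEqFun.coeFn_zero.symm,
    locallyIntegrableOn_congr hΩ (locallyIntegrableOn_zero) AEEqFun.coeFn_zero.symm, ?_⟩
  intro φ hφ hc hs i
  have e3 : ∫ x in Ω, (0 : EuclideanSpace ℝ (Fin N) →ₘ[volume.restrict Ω] ℝ) x *
      fderiv ℝ φ x (EuclideanSpace.single i 1) = 0 := by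
    refine integral_eq_zero_of_ae ?_
    filter_upwards [AEEqFun.coeFn_zero (α := EuclideanSpace ℝ (Fin N)) (β := ℝ)
      (μ := volume.restrict Ω)] with x hx
    simp [hx]
  have e4 : ∫ x in Ω, (0 : EuclideanSpace ℝ (Fin N) →ₘ[volume.restrict Ω]
      EuclideanSpace ℝ (Fin N)) x i * φ x = 0 := by
    refine integral_eq_zero_of_ae ?_
    filter_upwards [AEEqFun.coeFn_zero (α := EuclideanSpace ℝ (Fin N))
      (β := EuclideanSpace ℝ (Fin N)) (μ := volume.restrict Ω)] with x hx
    simp [hx]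
  rw [e3, e4, neg_zero]

theorem IsWeakGradient.weakGradient_eq (hΩ : IsOpen Ω)
    {u : EuclideanSpace ℝ (Fin N) →ₘ[volume.restrict Ω] ℝ}
    {g : EuclideanSpace ℝ (Fin N) →ₘ[volume.restrict Ω] EuclideanSpace ℝ (Fin N)}
    (h : IsWeakGradient Ω u g) : weakGradient Ω u = g := by
  have h' : ∃ g, IsWeakGradient Ω u g := ⟨g, h⟩
  rw [weakGradient, dif_pos h']
  exact h'.choose_spec.unique hΩ h

end WeakGradient

section Modular

variable {N : ℕ} {Ω : Set (EuclideanSpace ℝ (Fin N))} {p q μ : EuclideanSpace ℝ (Fin N) → ℝ}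

theorem H_nonneg {x : EuclideanSpace ℝ (Fin N)} (hμ : 0 ≤ μ x) {t : ℝ} (ht : 0 ≤ t) :
    0 ≤ H p q μ x t :=
  add_nonneg (Real.rpow_nonneg ht _) (mul_nonneg hμ (Real.rpow_nonneg ht _))

theorem H_mono {x : EuclideanSpace ℝ (Fin N)} (hp : 1 < p x) (hpq : p x < q x) (hμ : 0 ≤ μ x)
    {s t : ℝ} (hs : 0 ≤ s) (hst : s ≤ t) : H p q μ x s ≤ H p q μ x t :=
  add_le_add (Real.rpow_le_rpow hs hst (by linarith))
    (mul_le_mul_of_nonneg_left (Real.rpow_le_rpow hs hst (by linarith)) hμ)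

theorem H_convex {x : EuclideanSpace ℝ (Fin N)} (hp : 1 < p x) (hpq : p x < q x) (hμ : 0 ≤ μ x)
    {s t a b : ℝ} (hs : 0 ≤ s) (ht : 0 ≤ t) (ha : 0 ≤ a) (hb : 0 ≤ b) (hab : a + b = 1) :
    H p q μ x (a * s + b * t) ≤ a * H p q μ x s + b * H p q μ x t := by
  have h1 := (convexOn_rpow hp.le).2 hs ht ha hb hab
  have h2 := (convexOn_rpow (hp.trans hpq).le).2 hs ht ha hb hab
  simp only [smul_eq_mul] at h1 h2
  have h3 := mul_le_mul_of_nonneg_left h2 hμ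
  unfold H
  linarith

theorem H_mul_le {x : EuclideanSpace ℝ (Fin N)} (hpq : p x < q x) (hμ : 0 ≤ μ x)
    {Q c t : ℝ} (hQ : q x ≤ Q) (hc : 1 ≤ c) (ht : 0 ≤ t) :
    H p q μ x (c * t) ≤ c ^ Q * H p q μ x t := by
  have hc0 : 0 ≤ c := by linarith
  have h1 : c ^ p x ≤ c ^ Q := Real.rpow_le_rpow_of_exponent_le hc (by linarith)
  have h2 : c ^ q x ≤ c ^ Q := Real.rpow_le_rpow_of_exponent_le hc hQ
  have h3 := mul_le_mul_of_nonneg_right h1 (Real.rpow_nonneg ht (p x))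
  have h4 := mul_le_mul_of_nonneg_left
    (mul_le_mul_of_nonneg_right h2 (Real.rpow_nonneg ht (q x))) hμ
  unfold H
  rw [Real.mul_rpow hc0 ht, Real.mul_rpow hc0 ht]
  linarith

theorem Hypotheses.ae_exponents (h : Hypotheses Ω p q μ) :
    ∀ᵐ x ∂(volume.restrict Ω), x ∈ Ω ∧ 1 < p x ∧ p x < q x ∧ 0 ≤ μ x := by
  filter_upwards [h.weight_nonneg, ae_restrict_mem h.isOpen.measurableSet] with x hx hxΩ
  exact ⟨hxΩ, h.one_lt_p x (subset_closure hxΩ), h.p_lt_q x (subset_closure hxΩ), hx⟩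

variable {F : Type*} [NormedAddCommGroup F]

theorem Hypotheses.aemeasurable_H (h : Hypotheses Ω p q μ)
    (v : EuclideanSpace ℝ (Fin N) →ₘ[volume.restrict Ω] F) :
    AEMeasurable (fun x => ENNReal.ofReal (H p q μ x ‖v x‖)) (volume.restrict Ω) := by
  have hp : AEMeasurable p (volume.restrict Ω) :=
    (h.continuousOn_p.mono subset_closure).aemeasurable h.isOpen.measurableSet
  have hq : AEMeasurable q (volume.restrict Ω) :=
    (h.continuousOn_q.mono subset_closure).aemeasurable h.isOpen.measurableSet
  have hμ : AEMeasurable μ (volume.restrict Ω) := h.weight_integrable.aestronglyMeasurable.aemeasurable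
  have hv : AEMeasurable (fun x => ‖v x‖) (volume.restrict Ω) :=
    v.aestronglyMeasurable.norm.aemeasurable
  exact ((hv.pow hp).add (hμ.mul (hv.pow hq))).ennreal_ofReal

theorem Hypotheses.modular_zero (h : Hypotheses Ω p q μ) :
    modular Ω p q μ (0 : EuclideanSpace ℝ (Fin N) →ₘ[volume.restrict Ω] F) = 0 := by
  unfold modular
  rw [lintegral_eq_zero_iff' (h.aemeasurable_H _)]
  filter_upwards [h.ae_exponents, AEEqFun.coeFn_zero (α := EuclideanSpace ℝ (Fin N)) (β := F)
      (μ := volume.restrict Ω)] with x ⟨_, hp, hpq, _⟩ hx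
  have h1 : p x ≠ 0 := by linarith
  have h2 : q x ≠ 0 := by linarith
  simp [hx, H, Real.zero_rpow h1, Real.zero_rpow h2]

theorem Hypotheses.eq_zero_of_modular (h : Hypotheses Ω p q μ)
    (v : EuclideanSpace ℝ (Fin N) →ₘ[volume.restrict Ω] F) (hv : modular Ω p q μ v = 0) :
    v = 0 := by
  unfold modular at hv
  rw [lintegral_eq_zero_iff' (h.aemeasurable_H _)] at hv
  apply AEEqFun.ext
  filter_upwards [h.ae_exponents, hv, AEEqFun.coeFn_zero (α := EuclideanSpace ℝ (Fin N)) (β := F)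
      (μ := volume.restrict Ω)] with x ⟨_, hp, hpq, hμ⟩ hx h0
  rw [h0, Pi.zero_apply]
  by_contra hne
  have hpos : 0 < ‖v x‖ := norm_pos_iff.2 hne
  have h1 : 0 < H p q μ x ‖v x‖ :=
    add_pos_of_pos_of_nonneg (Real.rpow_pos_of_pos hpos _)
      (mul_nonneg hμ (Real.rpow_nonneg hpos.le _))
  have h2 := ENNReal.ofReal_pos.2 h1
  exact h2.ne' hx

variable [NormedSpace ℝ F]

theorem Hypotheses.modular_convex (h : Hypotheses Ω p q μ) {a b : ℝ} (ha : 0 ≤ a) (hb : 0 ≤ b)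
    (hab : a + b = 1) (u v : EuclideanSpace ℝ (Fin N) →ₘ[volume.restrict Ω] F) :
    modular Ω p q μ (a • u + b • v)
      ≤ ENNReal.ofReal a * modular Ω p q μ u + ENNReal.ofReal b * modular Ω p q μ v := by
  unfold modular
  rw [← lintegral_const_mul'' _ (h.aemeasurable_H u), ← lintegral_const_mul'' _ (h.aemeasurable_H v),
    ← lintegral_add_left' ((h.aemeasurable_H u).const_mul _)]
  refine lintegral_mono_ae ?_
  filter_upwards [h.ae_exponents, AEEqFun.coeFn_add (a • u) (b • v), AEEqFun.coeFn_smul a u,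
    AEEqFun.coeFn_smul b v] with x ⟨_, hp, hpq, hμ⟩ h1 h2 h3
  have e : (a • u + b • v : EuclideanSpace ℝ (Fin N) →ₘ[volume.restrict Ω] F) x
      = a • u x + b • v x := by
    rw [h1, Pi.add_apply, h2, h3, Pi.smul_apply, Pi.smul_apply]
  rw [e, ← ENNReal.ofReal_mul ha, ← ENNReal.ofReal_mul hb,
    ← ENNReal.ofReal_add (mul_nonneg ha (H_nonneg hμ (norm_nonneg _)))
      (mul_nonneg hb (H_nonneg hμ (norm_nonneg _)))]
  refine ENNReal.ofReal_le_ofReal ?_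
  refine le_trans (H_mono hp hpq hμ (norm_nonneg _) ?_)
    (H_convex hp hpq hμ (norm_nonneg _) (norm_nonneg _) ha hb hab)
  refine (norm_add_le _ _).trans (le_of_eq ?_)
  rw [norm_smul, norm_smul, Real.norm_of_nonneg ha, Real.norm_of_nonneg hb]

theorem Hypotheses.modular_smul_le (h : Hypotheses Ω p q μ) {c : ℝ} (hc : |c| ≤ 1)
    (u : EuclideanSpace ℝ (Fin N) →ₘ[volume.restrict Ω] F) :
    modular Ω p q μ (c • u) ≤ ENNReal.ofReal |c| * modular Ω p q μ u := by
  have h1 := h.modular_convex (abs_nonneg c) (sub_nonneg.2 hc) (by ring) u 0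
  rw [h.modular_zero, mul_zero, add_zero, smul_zero, add_zero] at h1
  refine le_trans (le_of_eq ?_) h1
  unfold modular
  refine lintegral_congr_ae ?_
  filter_upwards [AEEqFun.coeFn_smul c u, AEEqFun.coeFn_smul |c| u] with x h2 h3
  rw [h2, h3]
  simp [norm_smul]

theorem Hypotheses.modular_smul_lt_top (h : Hypotheses Ω p q μ) (c : ℝ)
    {u : EuclideanSpace ℝ (Fin N) →ₘ[volume.restrict Ω] F} (hu : modular Ω p q μ u < ⊤) :
    modular Ω p q μ (c • u) < ⊤ := by
  obtain ⟨Q, hQ⟩ := (h.isBounded.isCompact_closure.image_of_continuousOn h.continuousOn_q).bddAbove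
  have key : modular Ω p q μ (c • u)
      ≤ ENNReal.ofReal ((max 1 |c|) ^ Q) * modular Ω p q μ u := by
    unfold modular
    rw [← lintegral_const_mul'' _ (h.aemeasurable_H u)]
    refine lintegral_mono_ae ?_
    filter_upwards [h.ae_exponents, AEEqFun.coeFn_smul c u] with x ⟨hxΩ, hp, hpq, hμ⟩ h1
    rw [h1, ← ENNReal.ofReal_mul (by positivity)]
    refine ENNReal.ofReal_le_ofReal ?_
    refine le_trans (H_mono hp hpq hμ (norm_nonneg _) ?_)
      (H_mul_le hpq hμ (hQ ⟨x, subset_closure hxΩ, rfl⟩) (le_max_left _ _) (norm_nonneg _))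
    rw [Pi.smul_apply, norm_smul, Real.norm_eq_abs]
    exact mul_le_mul_of_nonneg_right (le_max_right _ _) (norm_nonneg _)
  exact key.trans_lt (ENNReal.mul_lt_top ENNReal.ofReal_lt_top hu)

theorem Hypotheses.modular_add_lt_top (h : Hypotheses Ω p q μ)
    {u v : EuclideanSpace ℝ (Fin N) →ₘ[volume.restrict Ω] F} (hu : modular Ω p q μ u < ⊤)
    (hv : modular Ω p q μ v < ⊤) : modular Ω p q μ (u + v) < ⊤ := by
  have e : u + v = (2 : ℝ) • ((1 / 2 : ℝ) • u + (1 / 2 : ℝ) • v) := by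
    rw [smul_add, smul_smul, smul_smul]
    norm_num
  rw [e]
  refine h.modular_smul_lt_top 2 ?_
  refine (h.modular_convex (by norm_num) (by norm_num) (by norm_num) u v).trans_lt ?_
  exact ENNReal.add_lt_top.2 ⟨ENNReal.mul_lt_top ENNReal.ofReal_lt_top hu,
    ENNReal.mul_lt_top ENNReal.ofReal_lt_top hv⟩

end Modular

/-- The Musielak-Orlicz Sobolev space `W^{1,H}(Ω)`, as a linear subspace of the space of (classes
of) measurable functions on `Ω`: the functions `u` that have a weak gradient and for which
`u ∈ L^H(Ω)` and `|∇u| ∈ L^H(Ω)`, that is, `ρ_H(u) < ∞` and `ρ_H(|∇u|) < ∞`. -/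
def sobolevSubmodule {N : ℕ} {Ω : Set (EuclideanSpace ℝ (Fin N))}
    {p q μ : EuclideanSpace ℝ (Fin N) → ℝ} (h : Hypotheses Ω p q μ) :
    Submodule ℝ (EuclideanSpace ℝ (Fin N) →ₘ[volume.restrict Ω] ℝ) where
  carrier := {u | (∃ g, IsWeakGradient Ω u g) ∧ modular Ω p q μ u < ⊤ ∧
    modular Ω p q μ (weakGradient Ω u) < ⊤}
  zero_mem' := by
    refine ⟨⟨0, isWeakGradient_zero h.isOpen⟩, ?_, ?_⟩
    · rw [h.modular_zero]
      exact ENNReal.zero_lt_top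
    · rw [(isWeakGradient_zero h.isOpen).weakGradient_eq h.isOpen, h.modular_zero]
      exact ENNReal.zero_lt_top
  add_mem' := by
    rintro u v ⟨⟨g, hg⟩, hu, hu'⟩ ⟨⟨k, hk⟩, hv, hv'⟩
    rw [hg.weakGradient_eq h.isOpen] at hu'
    rw [hk.weakGradient_eq h.isOpen] at hv'
    refine ⟨⟨g + k, hg.add h.isOpen hk⟩, h.modular_add_lt_top hu hv, ?_⟩
    rw [(hg.add h.isOpen hk).weakGradient_eq h.isOpen]
    exact h.modular_add_lt_top hu' hv'
  smul_mem' := by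
    rintro c u ⟨⟨g, hg⟩, hu, hu'⟩
    rw [hg.weakGradient_eq h.isOpen] at hu'
    refine ⟨⟨c • g, hg.smul h.isOpen c⟩, h.modular_smul_lt_top c hu, ?_⟩
    rw [(hg.smul h.isOpen c).weakGradient_eq h.isOpen]
    exact h.modular_smul_lt_top c hu'

/-- The space `W^{1,H}(Ω)` as a type; below it is endowed with the norm `‖·‖_{ρ̂_H}`. -/
def W1H {N : ℕ} {Ω : Set (EuclideanSpace ℝ (Fin N))}
    {p q μ : EuclideanSpace ℝ (Fin N) → ℝ} (h : Hypotheses Ω p q μ) : Type :=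
  sobolevSubmodule h

namespace W1H

variable {N : ℕ} {Ω : Set (EuclideanSpace ℝ (Fin N))} {p q μ : EuclideanSpace ℝ (Fin N) → ℝ}
  {h : Hypotheses Ω p q μ}

instance instAddCommGroup : AddCommGroup (W1H h) :=
  inferInstanceAs (AddCommGroup (sobolevSubmodule h))

instance instModule : Module ℝ (W1H h) :=
  inferInstanceAs (Module ℝ (sobolevSubmodule h))

/-- The function underlying an element of `W^{1,H}(Ω)`. -/
def toAEEqFun : W1H h →ₗ[ℝ] (EuclideanSpace ℝ (Fin N) →ₘ[volume.restrict Ω] ℝ) :=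
  (sobolevSubmodule h).subtype

/-- The modular `ρ̂_H(u) = ∫_Ω H(x, |∇u|) dx + ∫_Ω H(x, |u|) dx`. -/
def modularHat (u : W1H h) : ℝ≥0∞ :=
  modular Ω p q μ (weakGradient Ω (toAEEqFun u)) + modular Ω p q μ (toAEEqFun u)

/-- The norm `‖u‖_{ρ̂_H} = inf {τ > 0 : ρ̂_H(u / τ) ≤ 1}`. -/
instance instNorm : Norm (W1H h) :=
  ⟨fun u => sInf {τ : ℝ | 0 < τ ∧ modularHat (τ⁻¹ • u) ≤ 1}⟩

theorem exists_isWeakGradient (u : W1H h) : ∃ g, IsWeakGradient Ω (toAEEqFun u) g := u.2.1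

theorem isWeakGradient (u : W1H h) :
    IsWeakGradient Ω (toAEEqFun u) (weakGradient Ω (toAEEqFun u)) := by
  obtain ⟨g, hg⟩ := exists_isWeakGradient u
  rwa [hg.weakGradient_eq h.isOpen]

theorem weakGradient_add (u v : W1H h) : weakGradient Ω (toAEEqFun (u + v))
    = weakGradient Ω (toAEEqFun u) + weakGradient Ω (toAEEqFun v) := by
  rw [map_add]
  exact ((isWeakGradient u).add h.isOpen (isWeakGradient v)).weakGradient_eq h.isOpen

theorem weakGradient_smul (c : ℝ) (u : W1H h) : weakGradient Ω (toAEEqFun (c • u))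
    = c • weakGradient Ω (toAEEqFun u) := by
  rw [map_smul]
  exact ((isWeakGradient u).smul h.isOpen c).weakGradient_eq h.isOpen

theorem modularHat_lt_top (u : W1H h) : modularHat u < ⊤ :=
  ENNReal.add_lt_top.2 ⟨u.2.2.2, u.2.2.1⟩

theorem modularHat_convex {a b : ℝ} (ha : 0 ≤ a) (hb : 0 ≤ b) (hab : a + b = 1) (u v : W1H h) :
    modularHat (a • u + b • v)
      ≤ ENNReal.ofReal a * modularHat u + ENNReal.ofReal b * modularHat v := by
  unfold modularHat
  rw [weakGradient_add, weakGradient_smul, weakGradient_smul, map_add, map_smul, map_smul]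
  refine (add_le_add (h.modular_convex ha hb hab _ _) (h.modular_convex ha hb hab _ _)).trans
    (le_of_eq ?_)
  ring

theorem modularHat_smul_le {c : ℝ} (hc : |c| ≤ 1) (u : W1H h) :
    modularHat (c • u) ≤ ENNReal.ofReal |c| * modularHat u := by
  unfold modularHat
  rw [weakGradient_smul, map_smul, mul_add]
  exact add_le_add (h.modular_smul_le hc _) (h.modular_smul_le hc _)

theorem eq_zero_of_modularHat {u : W1H h} (hu : modularHat u = 0) : u = 0 := by
  have h1 : toAEEqFun u = 0 := h.eq_zero_of_modular _ (add_eq_zero.1 hu).2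
  exact Subtype.ext h1

/-- The unit modular ball. -/
def unitBall (h : Hypotheses Ω p q μ) : Set (W1H h) := {u | modularHat u ≤ 1}

theorem norm_eq_gauge (u : W1H h) : ‖u‖ = gauge (unitBall h) u := by
  rw [gauge_def']
  rfl

theorem convex_unitBall : Convex ℝ (unitBall h) := by
  intro u hu v hv a b ha hb hab
  refine (modularHat_convex ha hb hab u v).trans ?_
  calc ENNReal.ofReal a * modularHat u + ENNReal.ofReal b * modularHat v
      ≤ ENNReal.ofReal a * 1 + ENNReal.ofReal b * 1 := by gcongr <;> assumption
    _ = 1 := by rw [mul_one, mul_one, ← ENNReal.ofReal_add ha hb, hab, ENNReal.ofReal_one]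

theorem balanced_unitBall : Balanced ℝ (unitBall h) := by
  rw [balanced_iff_smul_mem]
  intro c hc u hu
  refine (modularHat_smul_le hc u).trans ?_
  calc ENNReal.ofReal |c| * modularHat u ≤ 1 * 1 := by
        gcongr
        · exact ENNReal.ofReal_le_one.2 hc
        · exact hu
    _ = 1 := one_mul 1

theorem modularHat_smul_le_of_pos {t : ℝ} (ht : 0 ≤ t) (ht1 : t ≤ 1) (u : W1H h) :
    modularHat (t • u) ≤ ENNReal.ofReal t * modularHat u := by
  have := modularHat_smul_le (c := t) (by rwa [abs_of_nonneg ht]) u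
  rwa [abs_of_nonneg ht] at this

theorem absorbent_unitBall : Absorbent ℝ (unitBall h) := by
  rw [absorbent_iff_inv_smul]
  intro u
  filter_upwards [eventually_cobounded_le_norm (E := ℝ) (max 1 (modularHat u).toReal)] with c hc
  have hc1 : 1 ≤ |c| := (le_max_left _ _).trans hc
  have hcu : (modularHat u).toReal ≤ |c| := (le_max_right _ _).trans hc
  have hc0 : 0 < |c| := by linarith
  have h1 : |c⁻¹| ≤ 1 := by
    rw [abs_inv]
    exact inv_le_one_of_one_le₀ hc1
  refine (modularHat_smul_le h1 u).trans ?_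
  rw [← ENNReal.ofReal_toReal (modularHat_lt_top u).ne, ← ENNReal.ofReal_mul (abs_nonneg _),
    ENNReal.ofReal_le_one, abs_inv]
  rw [inv_mul_le_iff₀ hc0]
  linarith

theorem eq_zero_of_norm_eq_zero {u : W1H h} (hu : ‖u‖ = 0) : u = 0 := by
  apply eq_zero_of_modularHat
  by_contra hne
  have hpos : 0 < (modularHat u).toReal := ENNReal.toReal_pos hne (modularHat_lt_top u).ne
  have hlt : gauge (unitBall h) u < min 1 ((modularHat u).toReal / 2) := by
    rw [← norm_eq_gauge, hu]
    positivity
  obtain ⟨t, ht0, htlt, w, hw, rfl⟩ := exists_lt_of_gauge_lt absorbent_unitBall hlt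
  have h1 : t ≤ 1 := htlt.le.trans (min_le_left _ _)
  have h2 := htlt.trans_le (min_le_right _ _)
  have h3 : modularHat (t • w) ≤ ENNReal.ofReal t := by
    refine (modularHat_smul_le_of_pos ht0.le h1 w).trans ?_
    calc ENNReal.ofReal t * modularHat w ≤ ENNReal.ofReal t * 1 := by gcongr; exact hw
      _ = _ := mul_one _
  have h4 := ENNReal.toReal_le_of_le_ofReal ht0.le h3
  simp only at h2 hpos
  linarith

theorem normedSpaceCore (h : Hypotheses Ω p q μ) : NormedSpace.Core ℝ (W1H h) where
  norm_nonneg u := by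
    rw [norm_eq_gauge]
    exact gauge_nonneg u
  norm_smul c u := by
    rw [norm_eq_gauge, norm_eq_gauge, gauge_smul balanced_unitBall]
  norm_triangle u v := by
    rw [norm_eq_gauge, norm_eq_gauge, norm_eq_gauge]
    exact gauge_add_le convex_unitBall absorbent_unitBall u v
  norm_eq_zero_iff u := by
    refine ⟨eq_zero_of_norm_eq_zero, ?_⟩
    rintro rfl
    rw [norm_eq_gauge, gauge_zero]

/-- `W^{1,H}(Ω)` normed by `‖·‖_{ρ̂_H}`. -/
instance instNormedAddCommGroup : NormedAddCommGroup (W1H h) :=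
  NormedAddCommGroup.ofCore (normedSpaceCore h)

instance instNormedSpace : NormedSpace ℝ (W1H h) :=
  NormedSpace.ofCore (normedSpaceCore h)

end W1H

end DoublePhase

end

/-! Both statements rest on one inequality for the modular: for each ε > 0 there is δ > 0 with
ρ((u+v)/2) + δ ρ((u-v)/2) ≤ (1/2 + δε)(ρ(u) + ρ(v)). It holds pointwise for the powers ‖·‖^s by
strict convexity and compactness (`exists_uniform_convexity`), with one δ for all s in a compact
subinterval of (1, ∞). It therefore survives adding the p(x) and q(x) terms, weighting by μ and
integrating, and applies to functions and gradients alike (`exists_realModular_uniform_convexity`).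

Since q is bounded, ρ(cu) ≤ c^Q ρ(u) for c ≥ 1. Hence a small modular forces a small norm, and a
modular bounded away below 1 forces a norm bounded away below 1; this turns uniform convexity of ρ
into that of the norm.

For (ii), ρ is convex and continuous, hence weakly lower semicontinuous. The midpoints of u_n and u
converge weakly to u, so their modulars cannot fall asymptotically below ρ(u). The inequality then
squeezes ρ((u_n-u)/2) to 0. -/

namespace DoublePhase

/-! ### Uniform convexity of the powers of a norm -/

section Pointwise

variable {F : Type*} [NormedAddCommGroup F] [NormedSpace ℝ F]

/-- If the two norms agree, strict convexity of the space makes the midpoint strictly shorter; if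
they differ, strict convexity of t ↦ t^s gives the gap. -/
theorem norm_midpoint_rpow_lt [StrictConvexSpace ℝ F] {s : ℝ} (hs : 1 < s) {a b : F}
    (hab : a ≠ b) :
    ‖(1 / 2 : ℝ) • a + (1 / 2 : ℝ) • b‖ ^ s < 1 / 2 * (‖a‖ ^ s + ‖b‖ ^ s) := by
  have hs0 : 0 < s := by linarith
  rcases eq_or_ne ‖a‖ ‖b‖ with hn | hn
  · have h1 := norm_combo_lt_of_ne (le_refl ‖a‖) hn.ge hab
      (by norm_num : (0 : ℝ) < 1 / 2) (by norm_num : (0 : ℝ) < 1 / 2) (by norm_num)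
    have h2 := Real.rpow_lt_rpow (norm_nonneg _) h1 hs0
    rw [← hn]
    linarith
  · have h1 := (strictConvexOn_rpow hs).2 (norm_nonneg a) (norm_nonneg b) hn
      (by norm_num : (0 : ℝ) < 1 / 2) (by norm_num : (0 : ℝ) < 1 / 2) (by norm_num)
    simp only [smul_eq_mul] at h1
    have h2 : ‖(1 / 2 : ℝ) • a + (1 / 2 : ℝ) • b‖ ≤ 1 / 2 * ‖a‖ + 1 / 2 * ‖b‖ := by
      refine (norm_add_le _ _).trans (le_of_eq ?_)
      rw [norm_smul, norm_smul, Real.norm_of_nonneg (by norm_num)]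
    have h3 := Real.rpow_le_rpow (norm_nonneg _) h2 hs0.le
    linarith

theorem norm_midpoint_rpow_le [StrictConvexSpace ℝ F] {s : ℝ} (hs : 1 < s) (a b : F) :
    ‖(1 / 2 : ℝ) • a + (1 / 2 : ℝ) • b‖ ^ s ≤ 1 / 2 * (‖a‖ ^ s + ‖b‖ ^ s) := by
  rcases eq_or_ne a b with rfl | hab
  · rw [← add_smul]
    norm_num
    linarith
  · exact (norm_midpoint_rpow_lt hs hab).le

/-- Uniform convexity of the powers `‖·‖ ^ s`, uniformly for `s` in a compact subinterval of
`(1, ∞)`, on normalized pairs. -/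
theorem exists_uniform_convexity_normalized [StrictConvexSpace ℝ F] [FiniteDimensional ℝ F]
    {P Q ε : ℝ} (hP : 1 < P) (hε : 0 < ε) :
    ∃ δ₀ : ℝ, 0 < δ₀ ∧ ∀ δ, 0 < δ → δ ≤ δ₀ → ∀ s ∈ Icc P Q, ∀ a b : F, ‖a‖ + ‖b‖ = 1 →
      ‖(1 / 2 : ℝ) • a + (1 / 2 : ℝ) • b‖ ^ s + δ * ‖(1 / 2 : ℝ) • a + (-(1 / 2) : ℝ) • b‖ ^ s
        ≤ (1 / 2 + δ * ε) * (‖a‖ ^ s + ‖b‖ ^ s) := by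
  have : ProperSpace F := FiniteDimensional.proper ℝ F
  let K₀ : Set (ℝ × F × F) :=
    Icc P Q ×ˢ ((Metric.closedBall 0 1 ×ˢ Metric.closedBall 0 1) ∩ {y | ‖y.1‖ + ‖y.2‖ = 1})
  have hK₀ : IsCompact K₀ := by
    refine isCompact_Icc.prod (((isCompact_closedBall _ _).prod (isCompact_closedBall _ _)).inter_right
      (isClosed_eq (by fun_prop) continuous_const))
  -- `G` is the convexity gap; `D` is the excess of the half-difference over the error term. The
  -- claim is δ `D` ≤ `G`, which needs work only where `D` ≥ 0.
  let G : ℝ × F × F → ℝ := fun z =>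
    1 / 2 * (‖z.2.1‖ ^ z.1 + ‖z.2.2‖ ^ z.1) - ‖(1 / 2 : ℝ) • z.2.1 + (1 / 2 : ℝ) • z.2.2‖ ^ z.1
  let D : ℝ × F × F → ℝ := fun z =>
    ‖(1 / 2 : ℝ) • z.2.1 + (-(1 / 2) : ℝ) • z.2.2‖ ^ z.1 - ε * (‖z.2.1‖ ^ z.1 + ‖z.2.2‖ ^ z.1)
  have hpow : ∀ f : ℝ × F × F → F, Continuous f → ContinuousOn (fun z => ‖f z‖ ^ z.1) K₀ := by
    intro f hf
    refine hf.norm.continuousOn.rpow continuous_fst.continuousOn ?_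
    intro z hz
    -- At a zero base the real power is continuous only because the exponent is positive.
    right
    linarith [hz.1.1]
  have hG : ContinuousOn G K₀ := by
    refine ContinuousOn.sub (continuousOn_const.mul ?_) (hpow _ (by fun_prop))
    exact (hpow _ (by fun_prop)).add (hpow _ (by fun_prop))
  have hD : ContinuousOn D K₀ := by
    refine ContinuousOn.sub (hpow _ (by fun_prop)) (continuousOn_const.mul ?_)
    exact (hpow _ (by fun_prop)).add (hpow _ (by fun_prop))
  have hK : IsCompact (K₀ ∩ D ⁻¹' Ici 0) :=
    hK₀.of_isClosed_subset (hD.preimage_isClosed_of_isClosed hK₀.isClosed isClosed_Ici)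
      inter_subset_left
  have hpos : ∀ z ∈ K₀ ∩ D ⁻¹' Ici 0, 0 < G z := by
    rintro ⟨s, a, b⟩ ⟨⟨hs, -, hab⟩, hz⟩
    simp only [mem_ofPred_eq] at hab
    have hs1 : 1 < s := hP.trans_le hs.1
    have hne : a ≠ b := by
      rintro rfl
      have ha : 0 < ‖a‖ := by linarith
      have h1 : 0 < ‖a‖ ^ s := Real.rpow_pos_of_pos ha s
      have h2 : (1 / 2 : ℝ) • a + (-(1 / 2) : ℝ) • a = 0 := by rw [← add_smul]; simp
      have h3 : (0 : ℝ) ^ s = 0 := Real.zero_rpow (by linarith)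
      -- On the diagonal `D` = -2ε‖a‖^s < 0, so the set where `D` ≥ 0 avoids it.
      simp only [mem_preimage, mem_Ici, D, h2, norm_zero, h3] at hz
      nlinarith
    exact sub_pos.2 (norm_midpoint_rpow_lt hs1 hne)
  obtain ⟨m, hm0, hm⟩ : ∃ m : ℝ, 0 < m ∧ ∀ z ∈ K₀ ∩ D ⁻¹' Ici 0, m ≤ G z := by
    -- For large ε the set may be empty; any positive `m` then serves.
    rcases (K₀ ∩ D ⁻¹' Ici 0).eq_empty_or_nonempty with he | hne
    · exact ⟨1, one_pos, fun z hz => by simp [he] at hz⟩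
    · obtain ⟨z, hz, hmin⟩ := hK.exists_isMinOn hne (hG.mono inter_subset_left)
      exact ⟨G z, hpos z hz, fun w hw => hmin hw⟩
  refine ⟨m, hm0, ?_⟩
  intro δ hδ hδm s hs a b hab
  have hs1 : 1 < s := hP.trans_le hs.1
  have hK₀' : (s, a, b) ∈ K₀ := by
    refine ⟨hs, ⟨?_, ?_⟩, hab⟩
    · rw [mem_closedBall_zero_iff]; linarith [norm_nonneg b]
    · rw [mem_closedBall_zero_iff]; linarith [norm_nonneg a]
  have hG0 : 0 ≤ G (s, a, b) := sub_nonneg.2 (norm_midpoint_rpow_le hs1 a b)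
  have hD1 : D (s, a, b) ≤ 1 := by
    have h1 : ‖(1 / 2 : ℝ) • a + (-(1 / 2) : ℝ) • b‖ ≤ 1 := by
      refine (norm_add_le _ _).trans ?_
      rw [norm_smul, norm_smul, norm_neg, Real.norm_of_nonneg (by norm_num)]
      linarith
    have h2 := Real.rpow_le_one (norm_nonneg _) h1 (by linarith : 0 ≤ s)
    have h3 : 0 ≤ ε * (‖a‖ ^ s + ‖b‖ ^ s) := by positivity
    simp only [D]
    linarith
  have key : δ * D (s, a, b) ≤ G (s, a, b) := by
    rcases lt_or_ge (D (s, a, b)) 0 with hneg | hnn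
    · exact (mul_nonpos_of_nonneg_of_nonpos hδ.le hneg.le).trans hG0
    -- Here δ `D` ≤ δ ≤ `m` ≤ `G`, using `D` ≤ 1.
    · have := hm _ ⟨hK₀', hnn⟩
      nlinarith
  simp only [D, G] at key
  linarith

/-- Every term is homogeneous of degree s in (a, b), so dividing by ‖a‖ + ‖b‖ reduces to the
normalized case. -/
theorem exists_uniform_convexity [StrictConvexSpace ℝ F] [FiniteDimensional ℝ F]
    {P Q ε : ℝ} (hP : 1 < P) (hε : 0 < ε) :
    ∃ δ₀ : ℝ, 0 < δ₀ ∧ ∀ δ, 0 < δ → δ ≤ δ₀ → ∀ s ∈ Icc P Q, ∀ a b : F,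
      ‖(1 / 2 : ℝ) • a + (1 / 2 : ℝ) • b‖ ^ s + δ * ‖(1 / 2 : ℝ) • a + (-(1 / 2) : ℝ) • b‖ ^ s
        ≤ (1 / 2 + δ * ε) * (‖a‖ ^ s + ‖b‖ ^ s) := by
  obtain ⟨δ₀, hδ₀, h⟩ := exists_uniform_convexity_normalized (F := F) (Q := Q) hP hε
  refine ⟨δ₀, hδ₀, fun δ hδ hδδ₀ s hs a b => ?_⟩
  have hs0 : 0 < s := by linarith [hs.1]
  have hr0 : 0 ≤ ‖a‖ + ‖b‖ := by positivity
  rcases hr0.eq_or_lt with hr | hr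
  · have ha : a = 0 := norm_eq_zero.1 (by linarith [norm_nonneg a, norm_nonneg b])
    have hb : b = 0 := norm_eq_zero.1 (by linarith [norm_nonneg a, norm_nonneg b])
    simp [ha, hb, Real.zero_rpow hs0.ne']
  · set r := ‖a‖ + ‖b‖
    have hscale : ∀ x : F, ‖r • x‖ ^ s = r ^ s * ‖x‖ ^ s := fun x => by
      rw [norm_smul, Real.norm_of_nonneg hr0, Real.mul_rpow hr0 (norm_nonneg _)]
    have h1 := h δ hδ hδδ₀ s hs (r⁻¹ • a) (r⁻¹ • b) (by
      rw [norm_smul, norm_smul, ← mul_add, Real.norm_of_nonneg (by positivity)]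
      exact inv_mul_cancel₀ hr.ne')
    have h2 := mul_le_mul_of_nonneg_left h1 (Real.rpow_nonneg hr0 s)
    have e : ∀ c d : ℝ, c • a + d • b = r • (c • r⁻¹ • a + d • r⁻¹ • b) := fun c d => by
      rw [smul_add, smul_comm r c, smul_comm r d, smul_inv_smul₀ hr.ne', smul_inv_smul₀ hr.ne']
    have ea : ‖a‖ ^ s = r ^ s * ‖r⁻¹ • a‖ ^ s := by rw [← hscale, smul_inv_smul₀ hr.ne']
    have eb : ‖b‖ ^ s = r ^ s * ‖r⁻¹ • b‖ ^ s := by rw [← hscale, smul_inv_smul₀ hr.ne']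
    rw [e, e, hscale, hscale, ea, eb]
    linarith

end Pointwise

/-! ### Growth and uniform convexity of the modular -/

section Modular

variable {N : ℕ} {Ω : Set (EuclideanSpace ℝ (Fin N))} {p q μ : EuclideanSpace ℝ (Fin N) → ℝ}

/-- The exponents attain their extrema on the compact closure, so the lower bound stays strictly
above 1. -/
theorem Hypotheses.exists_exponent_bounds (h : Hypotheses Ω p q μ) :
    ∃ P Q : ℝ, 1 < P ∧ 0 < Q ∧ ∀ x ∈ Ω, P ≤ p x ∧ q x ≤ Q := by
  have hc : IsCompact (closure Ω) := h.isBounded.isCompact_closure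
  have hne : (closure Ω).Nonempty := h.isConnected.nonempty.closure
  obtain ⟨y, hy, hmin⟩ := hc.exists_isMinOn hne h.continuousOn_p
  obtain ⟨z, hz, hmax⟩ := hc.exists_isMaxOn hne h.continuousOn_q
  exact ⟨p y, q z, h.one_lt_p y hy, by linarith [h.one_lt_p z hz, h.p_lt_q z hz],
    fun x hx => ⟨hmin (subset_closure hx), hmax (subset_closure hx)⟩⟩

variable {F : Type*} [NormedAddCommGroup F] [NormedSpace ℝ F]

theorem Hypotheses.modular_smul_le_rpow (h : Hypotheses Ω p q μ) {Q : ℝ}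
    (hQ : ∀ x ∈ Ω, q x ≤ Q) {c : ℝ} (hc : 1 ≤ c)
    (u : EuclideanSpace ℝ (Fin N) →ₘ[volume.restrict Ω] F) :
    modular Ω p q μ (c • u) ≤ ENNReal.ofReal (c ^ Q) * modular Ω p q μ u := by
  unfold modular
  rw [← lintegral_const_mul'' _ (h.aemeasurable_H u)]
  refine lintegral_mono_ae ?_
  filter_upwards [h.ae_exponents, AEEqFun.coeFn_smul c u] with x ⟨hxΩ, _, hpq, hμ⟩ h1
  rw [h1, ← ENNReal.ofReal_mul (by positivity)]
  refine ENNReal.ofReal_le_ofReal ?_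
  rw [Pi.smul_apply, norm_smul, Real.norm_of_nonneg (by linarith)]
  exact H_mul_le hpq hμ (hQ x hxΩ) hc (norm_nonneg _)

/-- Uniform convexity of the modular `ρ_H`. -/
theorem Hypotheses.exists_modular_uniform_convexity [StrictConvexSpace ℝ F]
    [FiniteDimensional ℝ F] (h : Hypotheses Ω p q μ) {ε : ℝ} (hε : 0 < ε) :
    ∃ δ₀ : ℝ, 0 < δ₀ ∧ ∀ δ, 0 < δ → δ ≤ δ₀ →
      ∀ u v : EuclideanSpace ℝ (Fin N) →ₘ[volume.restrict Ω] F,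
      modular Ω p q μ ((1 / 2 : ℝ) • u + (1 / 2 : ℝ) • v)
          + ENNReal.ofReal δ * modular Ω p q μ ((1 / 2 : ℝ) • u + (-(1 / 2) : ℝ) • v)
        ≤ ENNReal.ofReal (1 / 2 + δ * ε) * (modular Ω p q μ u + modular Ω p q μ v) := by
  obtain ⟨P, Q, hP, -, hPQ⟩ := h.exists_exponent_bounds
  obtain ⟨δ₀, hδ₀, hδ₀'⟩ := exists_uniform_convexity (F := F) (Q := Q) hP hε
  refine ⟨δ₀, hδ₀, fun δ hδ hδδ₀ u v => ?_⟩
  unfold modular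
  rw [← lintegral_const_mul'' _ (h.aemeasurable_H _), ← lintegral_add_left' (h.aemeasurable_H _),
    ← lintegral_add_left' (h.aemeasurable_H _),
    ← lintegral_const_mul'' _ ((h.aemeasurable_H u).fun_add (h.aemeasurable_H v))]
  refine lintegral_mono_ae ?_
  have hcomb : ∀ c d : ℝ, ∀ᵐ x ∂(volume.restrict Ω),
      (c • u + d • v : EuclideanSpace ℝ (Fin N) →ₘ[volume.restrict Ω] F) x
        = c • u x + d • v x := fun c d => by
    filter_upwards [AEEqFun.coeFn_add (c • u) (d • v), AEEqFun.coeFn_smul c u,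
      AEEqFun.coeFn_smul d v] with x h1 h2 h3
    rw [h1, Pi.add_apply, h2, h3, Pi.smul_apply, Pi.smul_apply]
  filter_upwards [h.ae_exponents, hcomb (1 / 2) (1 / 2), hcomb (1 / 2) (-(1 / 2))]
    with x ⟨hxΩ, hp, hpq, hμ⟩ h1 h2
  have hH : ∀ w : F, 0 ≤ H p q μ x ‖w‖ := fun w => H_nonneg hμ (norm_nonneg w)
  rw [h1, h2, ← ENNReal.ofReal_mul hδ.le, ← ENNReal.ofReal_add (hH _) (mul_nonneg hδ.le (hH _)),
    ← ENNReal.ofReal_add (hH _) (hH _), ← ENNReal.ofReal_mul (by positivity)]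
  refine ENNReal.ofReal_le_ofReal ?_
  have hb := hPQ x hxΩ
  -- The same δ serves both exponents, so the two inequalities add after weighting the second by
  -- μ(x).
  have k1 := hδ₀' δ hδ hδδ₀ (p x) ⟨hb.1, by linarith⟩ (u x) (v x)
  have k2 := mul_le_mul_of_nonneg_left
    (hδ₀' δ hδ hδδ₀ (q x) ⟨by linarith, hb.2⟩ (u x) (v x)) hμ
  unfold H
  linarith

end Modular

/-! ### The modular on the Sobolev space -/

namespace W1H

variable {N : ℕ} {Ω : Set (EuclideanSpace ℝ (Fin N))} {p q μ : EuclideanSpace ℝ (Fin N) → ℝ}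
  {h : Hypotheses Ω p q μ}

/-- The modular `ρ̂_H` as a real number; it is finite on `W^{1,H}(Ω)`. -/
noncomputable def realModular (u : W1H h) : ℝ := (modularHat u).toReal

theorem ofReal_realModular (u : W1H h) : ENNReal.ofReal (realModular u) = modularHat u :=
  ENNReal.ofReal_toReal (modularHat_lt_top u).ne

theorem realModular_nonneg (u : W1H h) : 0 ≤ realModular u := ENNReal.toReal_nonneg

theorem modularHat_le_one_iff {u : W1H h} : modularHat u ≤ 1 ↔ realModular u ≤ 1 := by
  rw [← ofReal_realModular, ENNReal.ofReal_le_one]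

theorem convexOn_realModular : ConvexOn ℝ univ (realModular : W1H h → ℝ) := by
  refine ⟨convex_univ, fun u _ v _ a b ha hb hab => ?_⟩
  have h1 := modularHat_convex ha hb hab u v
  rw [← ofReal_realModular u, ← ofReal_realModular v, ← ENNReal.ofReal_mul ha,
    ← ENNReal.ofReal_mul hb, ← ENNReal.ofReal_add (mul_nonneg ha (realModular_nonneg u))
      (mul_nonneg hb (realModular_nonneg v))] at h1
  exact ENNReal.toReal_le_of_le_ofReal (add_nonneg (mul_nonneg ha (realModular_nonneg u))
      (mul_nonneg hb (realModular_nonneg v))) h1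

/-- This Δ₂-type growth bound is what makes modular estimates control the norm quantitatively. -/
theorem exists_realModular_smul_le (h : Hypotheses Ω p q μ) :
    ∃ Q : ℝ, 0 < Q ∧ ∀ c : ℝ, 1 ≤ c → ∀ u : W1H h,
      realModular (c • u) ≤ c ^ Q * realModular u := by
  obtain ⟨P, Q, -, hQ0, hPQ⟩ := h.exists_exponent_bounds
  refine ⟨Q, hQ0, fun c hc u => ?_⟩
  have hcQ : 0 ≤ c ^ Q := Real.rpow_nonneg (by linarith) _
  refine ENNReal.toReal_le_of_le_ofReal (mul_nonneg hcQ (realModular_nonneg u)) ?_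
  rw [ENNReal.ofReal_mul hcQ, ofReal_realModular]
  unfold modularHat
  rw [weakGradient_smul, map_smul, mul_add]
  exact add_le_add (h.modular_smul_le_rpow (fun x hx => (hPQ x hx).2) hc _)
    (h.modular_smul_le_rpow (fun x hx => (hPQ x hx).2) hc _)

/-- Uniform convexity of the modular `ρ̂_H`. -/
theorem exists_realModular_uniform_convexity (h : Hypotheses Ω p q μ) {ε : ℝ} (hε : 0 < ε) :
    ∃ δ : ℝ, 0 < δ ∧ ∀ u v : W1H h,
      realModular ((1 / 2 : ℝ) • u + (1 / 2 : ℝ) • v)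
          + δ * realModular ((1 / 2 : ℝ) • u + (-(1 / 2) : ℝ) • v)
        ≤ (1 / 2 + δ * ε) * (realModular u + realModular v) := by
  obtain ⟨δ₁, hδ₁, h₁⟩ := h.exists_modular_uniform_convexity (F := ℝ) hε
  obtain ⟨δ₂, hδ₂, h₂⟩ := h.exists_modular_uniform_convexity (F := EuclideanSpace ℝ (Fin N)) hε
  have hδ : 0 < min δ₁ δ₂ := lt_min hδ₁ hδ₂
  refine ⟨min δ₁ δ₂, hδ, fun u v => ?_⟩
  -- Function and gradient need a common δ; the minimum works because each inequality holds for
  -- every smaller positive δ.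
  have k1 := h₁ _ hδ (min_le_left _ _) (toAEEqFun u) (toAEEqFun v)
  have k2 := h₂ _ hδ (min_le_right _ _) (weakGradient Ω (toAEEqFun u))
    (weakGradient Ω (toAEEqFun v))
  have k := add_le_add k2 k1
  rw [← ENNReal.ofReal_le_ofReal_iff (mul_nonneg (by positivity)
      (add_nonneg (realModular_nonneg u) (realModular_nonneg v))),
    ENNReal.ofReal_add (realModular_nonneg _) (mul_nonneg hδ.le (realModular_nonneg _)),
    ENNReal.ofReal_mul hδ.le, ENNReal.ofReal_mul (by positivity),
    ENNReal.ofReal_add (realModular_nonneg _) (realModular_nonneg _), ofReal_realModular,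
    ofReal_realModular, ofReal_realModular, ofReal_realModular]
  unfold modularHat
  simp only [weakGradient_add, weakGradient_smul]
  simp only [map_add, map_smul]
  refine le_trans (le_of_eq ?_) (k.trans (le_of_eq ?_)) <;> ring

/-! ### Comparison of norm and modular; weak lower semicontinuity -/

theorem norm_le_of_realModular_le_one {τ : ℝ} (hτ : 0 < τ) {u : W1H h}
    (hu : realModular (τ⁻¹ • u) ≤ 1) : ‖u‖ ≤ τ :=
  csInf_le ⟨0, fun _ ht => ht.1.le⟩ ⟨hτ, modularHat_le_one_iff.2 hu⟩

theorem realModular_le_one_of_norm_lt_one {u : W1H h} (hu : ‖u‖ < 1) : realModular u ≤ 1 := by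
  rw [norm_eq_gauge] at hu
  obtain ⟨t, ht0, ht1, w, hw, rfl⟩ := exists_lt_of_gauge_lt absorbent_unitBall hu
  have h1 : t • w ∈ unitBall h :=
    balanced_unitBall.smul_mem (by rw [Real.norm_of_nonneg ht0.le]; exact ht1.le) hw
  exact modularHat_le_one_iff.1 h1

/-- A convex function bounded above near one point is continuous everywhere; here the bound is 1 on
the open unit ball. -/
theorem continuous_realModular : Continuous (realModular : W1H h → ℝ) := by
  rw [← continuousOn_univ]
  refine ((convexOn_realModular.continuousOn_tfae isOpen_univ univ_nonempty).out 3 1).1 ?_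
  refine ⟨0, mem_univ _, 1, ?_⟩
  rw [eventually_map]
  filter_upwards [Metric.ball_mem_nhds (0 : W1H h) one_pos] with u hu
  exact realModular_le_one_of_norm_lt_one (mem_ball_zero_iff.1 hu)

/-- Scaling by t < 1 moves into the open ball, and continuity lets t tend to 1. -/
theorem realModular_le_one_of_norm_le_one {u : W1H h} (hu : ‖u‖ ≤ 1) : realModular u ≤ 1 := by
  have h1 : Tendsto (fun t : ℝ => realModular (t • u)) (𝓝[<] 1) (𝓝 (realModular ((1 : ℝ) • u))) :=
    ((continuous_realModular.comp (continuous_id.smul continuous_const)).tendsto 1).mono_left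
      nhdsWithin_le_nhds
  rw [one_smul] at h1
  refine le_of_tendsto h1 ?_
  filter_upwards [Ioo_mem_nhdsLT (zero_lt_one' ℝ)] with t ht
  refine realModular_le_one_of_norm_lt_one ?_
  rw [norm_smul, Real.norm_of_nonneg ht.1.le]
  exact (mul_le_of_le_one_right ht.1.le hu).trans_lt ht.2

/-- The modular `ρ̂_H` is weakly sequentially lower semicontinuous. -/
theorem realModular_le_of_tendsto_weak {u : ℕ → W1H h} {u₀ : W1H h} {c : ℝ}
    (hu : Tendsto (fun n => toWeakSpace ℝ (W1H h) (u n)) atTop (𝓝 (toWeakSpace ℝ (W1H h) u₀)))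
    (hc : ∃ᶠ n in atTop, realModular (u n) ≤ c) : realModular u₀ ≤ c := by
  let s : Set (W1H h) := {w | realModular w ≤ c}
  have hs : Convex ℝ s := by simpa [s] using convexOn_realModular.convex_le c
  have hcl : IsClosed s := isClosed_le continuous_realModular continuous_const
  have h1 : toWeakSpace ℝ (W1H h) u₀ ∈ closure (toWeakSpace ℝ (W1H h) '' s) :=
    mem_closure_of_frequently_of_tendsto (hc.mono fun n hn => mem_image_of_mem _ hn) hu
  -- Mazur: the norm-closed convex sublevel set is weakly closed.
  rw [← hs.toWeakSpace_closure ℝ, hcl.closure_eq] at h1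
  obtain ⟨w, hw, hwu⟩ := h1
  rwa [← (toWeakSpace ℝ (W1H h)).injective hwu]

/-- With c = max(1, 1/ε), scaling by c raises the modular at most by c^Q, so η = c^(-Q) keeps it at
most 1. -/
theorem exists_norm_le_of_realModular_le (h : Hypotheses Ω p q μ) {ε : ℝ} (hε : 0 < ε) :
    ∃ η : ℝ, 0 < η ∧ ∀ u : W1H h, realModular u ≤ η → ‖u‖ ≤ ε := by
  obtain ⟨Q, -, hQ⟩ := exists_realModular_smul_le h
  have hc : 0 < max 1 ε⁻¹ := by positivity
  have hcQ : 0 < (max 1 ε⁻¹) ^ Q := Real.rpow_pos_of_pos hc Q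
  refine ⟨((max 1 ε⁻¹) ^ Q)⁻¹, inv_pos.2 hcQ, fun u hu => ?_⟩
  have h1 : ‖u‖ ≤ (max 1 ε⁻¹)⁻¹ := by
    refine norm_le_of_realModular_le_one (inv_pos.2 hc) ?_
    rw [inv_inv]
    refine (hQ _ (le_max_left _ _) u).trans ?_
    exact (mul_le_mul_of_nonneg_left hu hcQ.le).trans (mul_inv_cancel₀ hcQ.ne').le
  exact h1.trans (inv_le_of_inv_le₀ hε (le_max_right _ _))

theorem exists_norm_le_of_realModular_le_one_sub (h : Hypotheses Ω p q μ) {η : ℝ} (hη : 0 < η) :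
    ∃ κ : ℝ, 0 < κ ∧ ∀ u : W1H h, realModular u ≤ 1 - η → ‖u‖ ≤ 1 - κ := by
  obtain ⟨Q, hQ0, hQ⟩ := exists_realModular_smul_le h
  -- The bound 1/2 keeps θ positive when η ≥ 1. Scaling by θ^(-1/Q) multiplies the modular by at
  -- most 1/θ, giving norm at most θ^(1/Q) < 1.
  let θ := max (1 / 2) (1 - η)
  have hθ0 : 0 < θ := lt_max_of_lt_left (by norm_num)
  have hθ1 : θ < 1 := max_lt (by norm_num) (by linarith)
  have hτ0 : 0 < θ ^ Q⁻¹ := Real.rpow_pos_of_pos hθ0 _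
  have hτ1 : θ ^ Q⁻¹ < 1 := Real.rpow_lt_one hθ0.le hθ1 (inv_pos.2 hQ0)
  refine ⟨1 - θ ^ Q⁻¹, by linarith, fun u hu => ?_⟩
  rw [sub_sub_cancel]
  refine norm_le_of_realModular_le_one hτ0 ?_
  refine (hQ _ ((one_le_inv₀ hτ0).2 hτ1.le) u).trans ?_
  rw [Real.inv_rpow hτ0.le, Real.rpow_inv_rpow hθ0.le hQ0.ne', inv_mul_le_iff₀ hθ0, mul_one]
  exact hu.trans (le_max_right _ _)

/-! ### Uniform convexity of the norm and strong convergence -/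

theorem half_smul_sub (u v : W1H h) :
    (1 / 2 : ℝ) • u + (-(1 / 2) : ℝ) • v = (1 / 2 : ℝ) • (u - v) := by
  rw [smul_sub, neg_smul, sub_eq_add_neg]

theorem uniformConvexSpace (h : Hypotheses Ω p q μ) : UniformConvexSpace (W1H h) := by
  refine ⟨fun ε hε => ?_⟩
  -- As ‖(u-v)/2‖ ≥ ε/2 > ε/4, its modular exceeds η. With error parameter η/4, the midpoint has
  -- modular at most 1 + δη/2 - δη = 1 - δη/2.
  obtain ⟨η, hη, hη'⟩ := exists_norm_le_of_realModular_le h (by positivity : 0 < ε / 4)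
  obtain ⟨δ, hδ, hδ'⟩ := exists_realModular_uniform_convexity h (by positivity : 0 < η / 4)
  obtain ⟨κ, hκ, hκ'⟩ := exists_norm_le_of_realModular_le_one_sub h
    (by positivity : 0 < δ * (η / 2))
  refine ⟨2 * κ, by positivity, fun u hu v hv huv => ?_⟩
  have hlarge : η < realModular ((1 / 2 : ℝ) • u + (-(1 / 2) : ℝ) • v) := by
    by_contra! hle
    have h1 := hη' _ hle
    rw [half_smul_sub, norm_smul, Real.norm_of_nonneg (by norm_num)] at h1
    linarith
  have h1 := hδ' u v
  have h2 : (1 / 2 + δ * (η / 4)) * (realModular u + realModular v)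
      ≤ (1 / 2 + δ * (η / 4)) * (1 + 1) := by
    gcongr
    · exact realModular_le_one_of_norm_le_one hu.le
    · exact realModular_le_one_of_norm_le_one hv.le
  have h3 := mul_lt_mul_of_pos_left hlarge hδ
  have h4 := hκ' ((1 / 2 : ℝ) • u + (1 / 2 : ℝ) • v) (by linarith)
  rw [← smul_add, norm_smul, Real.norm_of_nonneg (by norm_num)] at h4
  linarith

/-- Lower semicontinuity bounds the midpoint modular from below, the assumed convergence bounds
ρ(u_n) from above, and uniform convexity leaves no room for the half-difference. -/
theorem eventually_realModular_half_sub_le {u : ℕ → W1H h} {u₀ : W1H h}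
    (hu : Tendsto (fun n => toWeakSpace ℝ (W1H h) (u n)) atTop (𝓝 (toWeakSpace ℝ (W1H h) u₀)))
    (hρ : Tendsto (fun n => realModular (u n)) atTop (𝓝 (realModular u₀))) {η : ℝ} (hη : 0 < η) :
    ∀ᶠ n in atTop, realModular ((1 / 2 : ℝ) • u n + (-(1 / 2) : ℝ) • u₀) ≤ η := by
  let M := realModular u₀
  have hM : 0 ≤ M := realModular_nonneg u₀
  obtain ⟨δ, hδ, hδ'⟩ := exists_realModular_uniform_convexity h
    (by positivity : 0 < η / (2 * (2 * M + 1)))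
  -- ζ ≤ 1 gives ρ(u_n) + M ≤ 2M + 1, so the error term costs at most δη/2; ζ ≤ δη/3 makes the
  -- remaining slack 3ζ/2 at most δη/2.
  let ζ := min 1 (δ * η / 3)
  have hζ0 : 0 < ζ := lt_min one_pos (by positivity)
  have hζ1 : ζ ≤ 1 := min_le_left _ _
  have hζ2 : ζ ≤ δ * η / 3 := min_le_right _ _
  have hmid : Tendsto (fun n => toWeakSpace ℝ (W1H h) ((1 / 2 : ℝ) • u n + (1 / 2 : ℝ) • u₀))
      atTop (𝓝 (toWeakSpace ℝ (W1H h) u₀)) := by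
    have h1 := (hu.const_smul (1 / 2 : ℝ)).add_const ((1 / 2 : ℝ) • toWeakSpace ℝ (W1H h) u₀)
    rw [← add_smul] at h1
    norm_num at h1
    simpa using h1
  have hlow : ∀ᶠ n in atTop, M - ζ < realModular ((1 / 2 : ℝ) • u n + (1 / 2 : ℝ) • u₀) := by
    by_contra hnot
    rw [not_eventually] at hnot
    have := realModular_le_of_tendsto_weak hmid (hnot.mono fun n hn => not_lt.1 hn)
    linarith
  have hupp : ∀ᶠ n in atTop, realModular (u n) < M + ζ :=
    hρ.eventually_lt_const (by linarith)
  filter_upwards [hlow, hupp] with n h1 h2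
  have h3 := hδ' (u n) u₀
  have h4 : δ * (η / (2 * (2 * M + 1))) * (realModular (u n) + M)
      ≤ δ * (η / (2 * (2 * M + 1))) * (2 * M + 1) :=
    mul_le_mul_of_nonneg_left (by linarith) (by positivity)
  have h5 : δ * (η / (2 * (2 * M + 1))) * (2 * M + 1) = δ * (η / 2) := by
    field_simp
  refine le_of_mul_le_mul_left ?_ hδ
  change _ ≤ (1 / 2 + _) * (realModular (u n) + M) at h3
  linarith

theorem tendsto_of_tendsto_weak_of_tendsto_modularHat {u : ℕ → W1H h} {u₀ : W1H h}
    (hu : Tendsto (fun n => toWeakSpace ℝ (W1H h) (u n)) atTop (𝓝 (toWeakSpace ℝ (W1H h) u₀)))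
    (hρ : Tendsto (fun n => modularHat (u n)) atTop (𝓝 (modularHat u₀))) :
    Tendsto u atTop (𝓝 u₀) := by
  have hρ' : Tendsto (fun n => realModular (u n)) atTop (𝓝 (realModular u₀)) :=
    (ENNReal.tendsto_toReal (modularHat_lt_top u₀).ne).comp hρ
  rw [Metric.tendsto_nhds]
  intro ε hε
  obtain ⟨η, hη, hη'⟩ := exists_norm_le_of_realModular_le h (by positivity : 0 < ε / 4)
  filter_upwards [eventually_realModular_half_sub_le hu hρ' hη] with n hn
  have h1 := hη' _ hn
  rw [half_smul_sub, norm_smul, Real.norm_of_nonneg (by norm_num)] at h1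
  rw [dist_eq_norm]
  linarith

end W1H

end DoublePhase

theorem mainTheorem9 {N : ℕ} {Ω : Set (EuclideanSpace ℝ (Fin N))}
    {p q μ : EuclideanSpace ℝ (Fin N) → ℝ} (h : DoublePhase.Hypotheses Ω p q μ) :
    UniformConvexSpace (DoublePhase.W1H h) ∧
    ∀ (u : ℕ → DoublePhase.W1H h) (u₀ : DoublePhase.W1H h),
      Tendsto (fun n => toWeakSpace ℝ (DoublePhase.W1H h) (u n)) atTop
        (𝓝 (toWeakSpace ℝ (DoublePhase.W1H h) u₀)) →
      Tendsto (fun n => DoublePhase.W1H.modularHat (u n)) atTop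
        (𝓝 (DoublePhase.W1H.modularHat u₀)) →
      Tendsto u atTop (𝓝 u₀) :=
  ⟨DoublePhase.W1H.uniformConvexSpace h, fun _ _ hu hρ =>
    DoublePhase.W1H.tendsto_of_tendsto_weak_of_tendsto_modularHat hu hρ⟩
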